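/- Let $K\subset\mathbb{R}^2$ be a finite union of convex sets, with area $1$. For each $n$ let $K_n$ be a set of $n$ points chosen independently and uniformly at random from $K$. A \emph{hole} is a subset of $K$ whose interior contains no point of $K_n$. For a set $L\subset\mathbb{R}^2$ let $\mathrm{Max}_L(K_n)$ be the largest area (supremum of the areas) of a hole homothetic to $L$, that is, of the form $v+rL$ with $v\in\mathbb{R}^2$ and $r>0$; let $\mathrm{Max}(K_n)$ be the largest area (supremum of the areas) of a convex hole; and let $\mathrm{PolyMax}(K_n)$ be the largest area of a hole that is a convex polygon with all its vertices in $K_n$ (or $0$ if there is none). Then: (1) for every bounded set $L\subset\mathbb{R}^2$ with nonempty interior, with high probability $\mathrm{Max}_L(K_n)=\Theta(\log n/n)$; (2) with high probability $\mathrm{Max}(K_n)=\Theta(\log n/n)$; (3) with high probability $\mathrm{PolyMax}(K_n)=\Theta(\log n/n)$. Here "with high probability $Y_n=\Theta(\log n/n)$" means that there are constants $c,C>0$, depending only on $K$ (and, in (1), on $L$), such that the probability that $c\log n/n\le Y_n\le C\log n/n$ tends to $1$ as $n\to\infty$. -/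

import Mathlib

open MeasureTheory Filter
open scoped ENNReal Pointwise Topology

noncomputable section

/-- The Euclidean plane. Area is Lebesgue measure `volume`. -/
abbrev Plane : Type := EuclideanSpace ℝ (Fin 2)

/-- `K` is the union of finitely many convex sets. -/
def IsFiniteUnionOfConvex (K : Set Plane) : Prop :=
  ∃ (m : ℕ) (C : Fin m → Set Plane), (∀ i, Convex ℝ (C i)) ∧ K = ⋃ i, C i

/-- The law of `n` independent points, each uniformly distributed on `K`. The measure
`ProbabilityTheory.cond volume K` is the restriction of Lebesgue measure to `K`, divided by
the area of `K`. -/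
def uniformPoints (K : Set Plane) (n : ℕ) : Measure (Fin n → Plane) :=
  Measure.pi fun _ => ProbabilityTheory.cond volume K

/-- `H` is a hole for the points `x 0, …, x (n - 1)` in `K`: a subset of `K` whose interior
contains none of the points. -/
def IsHole (K : Set Plane) {n : ℕ} (x : Fin n → Plane) (H : Set Plane) : Prop :=
  H ⊆ K ∧ ∀ i, x i ∉ interior H

/-- `H` is a (positively) homothetic copy of `L`. -/
def IsHomotheticTo (L H : Set Plane) : Prop :=
  ∃ (r : ℝ) (v : Plane), 0 < r ∧ H = v +ᵥ r • L

/-- `H` is a convex polygon all of whose vertices are among the points `x i`: the convex hull of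
some of these points. (Degenerate polygons are allowed here; they have area zero.) -/
def IsConvexPolygonOn {n : ℕ} (x : Fin n → Plane) (H : Set Plane) : Prop :=
  ∃ s : Finset (Fin n), H = convexHull ℝ (x '' (s : Set (Fin n)))

/-- The largest area (supremum of the areas) of a hole homothetic to `L`. -/
def maxHomothetic (L K : Set Plane) {n : ℕ} (x : Fin n → Plane) : ℝ≥0∞ :=
  ⨆ (H : Set Plane) (_ : IsHole K x H ∧ IsHomotheticTo L H), volume H

/-- The largest area (supremum of the areas) of a convex hole. -/
def maxConvex (K : Set Plane) {n : ℕ} (x : Fin n → Plane) : ℝ≥0∞ :=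
  ⨆ (H : Set Plane) (_ : IsHole K x H ∧ Convex ℝ H), volume H

/-- The largest area of a hole that is a convex polygon with vertices among the given points. -/
def maxPolygon (K : Set Plane) {n : ℕ} (x : Fin n → Plane) : ℝ≥0∞ :=
  ⨆ (H : Set Plane) (_ : IsHole K x H ∧ IsConvexPolygonOn x H), volume H

/-- With high probability `Y n = Θ (log n / n)`, where `Y n` is a function of `n` independent
uniform points of `K`: there are constants `0 < c` and `0 < C`, independent of `n`, such that the
probability that `c * log n / n ≤ Y n ≤ C * log n / n` fails tends to `0`. The failure event is
measured by outer measure, so no measurability of `Y n` is needed. -/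
def WhpThetaLogDiv (K : Set Plane) (Y : (n : ℕ) → (Fin n → Plane) → ℝ≥0∞) : Prop :=
  ∃ c C : ℝ, 0 < c ∧ 0 < C ∧
    Tendsto
      (fun n : ℕ => uniformPoints K n
        {x | ¬ (ENNReal.ofReal (c * (Real.log n / n)) ≤ Y n x ∧
                Y n x ≤ ENNReal.ofReal (C * (Real.log n / n)))})
      atTop (𝓝 0)

end

/-! A set of area `y` in `K` is missed by all `n` points with probability `(1 - y) ^ n`, so holes of
area of order `log n / n` are the largest that a polynomial number of candidate positions can be
expected to produce.

Upper bound: a bounded convex set contains a parallelogram of comparable area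
(`exists_openParallelogram_subset`), and after shrinking, this can be rounded to a lattice of mesh
`n⁻²` (`openParallelogram_perturb`). Full-dimensional convex holes are uniformly bounded, so
polynomially many lattice parallelograms suffice, and a union bound gives
`tendsto_large_convex_hole`. A polygonal hole is a convex hole, and a homothetic hole contains a
homothetic disc of proportional area, so this one bound serves all three maxima.

Lower bound: a square inside `K` is cut into small cells of area about `log n / n`. A cell is good
if the points avoid all of it except three small corner squares, each of which is hit. A second
moment argument (`measureReal_forall_notMem_diff_le`) shows that a good cell exists with high
probability (`tendsto_not_isGoodCell`). It contains an empty copy of `L` in its middle, and the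
smallest triangle with one sample point in each corner square is an empty polygon
(`IsGoodCell.exists_polygon`). -/

/-! ### Parallelograms: area, inscription in convex sets, stability under perturbation -/

/-- The determinant of two vectors of the plane. -/
def cross (u v : Plane) : ℝ := u 0 * v 1 - u 1 * v 0

/-- The open parallelogram with centre `p` and half-sides `u` and `v` (empty if `u` and `v` are
linearly dependent), described by inequalities. -/
def openParallelogram (p u v : Plane) : Set Plane :=
  {q | |cross (q - p) v| < |cross u v| ∧ |cross u (q - p)| < |cross u v|}

theorem continuous_plane_coord (i : Fin 2) : Continuous fun q : Plane => q i := by fun_prop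

theorem plane_ext {p q : Plane} (h0 : p 0 = q 0) (h1 : p 1 = q 1) : p = q := by
  ext i
  fin_cases i
  · exact h0
  · exact h1

theorem volume_rectangle (I J : Set ℝ) :
    volume {q : Plane | q 0 ∈ I ∧ q 1 ∈ J} = volume I * volume J := by
  have h := (EuclideanSpace.volume_preserving_symm_measurableEquiv_toLp (Fin 2)).measure_preimage_equiv
    (Set.univ.pi ![I, J])
  rw [volume_pi_pi, Fin.prod_univ_two] at h
  rw [show {q : Plane | q 0 ∈ I ∧ q 1 ∈ J} =
    (MeasurableEquiv.toLp 2 (Fin 2 → ℝ)).symm ⁻¹' (Set.univ.pi ![I, J]) from ?_, h]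
  · rfl
  · ext q
    simp only [Set.mem_preimage, Set.mem_pi, Set.mem_univ, true_implies, Fin.forall_fin_two]
    exact Iff.rfl

theorem isOpen_openParallelogram (p u v : Plane) : IsOpen (openParallelogram p u v) := by
  have h1 : Continuous fun q : Plane => |cross (q - p) v| := by unfold cross; fun_prop
  have h2 : Continuous fun q : Plane => |cross u (q - p)| := by unfold cross; fun_prop
  exact (isOpen_lt h1 continuous_const).inter (isOpen_lt h2 continuous_const)

theorem volume_openParallelogram (p u v : Plane) :
    volume (openParallelogram p u v) = ENNReal.ofReal (4 * |cross u v|) := by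
  by_cases hD : cross u v = 0
  · rw [show openParallelogram p u v = ∅ from ?_]
    · simp [hD]
    · ext q
      simp only [openParallelogram, hD, abs_zero, Set.mem_ofPred_eq, Set.mem_empty_iff_false,
        iff_false]
      intro h
      exact absurd h.1 (not_lt.mpr (abs_nonneg _))
  set b := (EuclideanSpace.basisFun (Fin 2) ℝ).toBasis with hb
  -- The adjugate of the matrix with columns `u`, `v`: it sends `q` to `(cross q v, cross u q)` and
  -- so turns the parallelogram into an axis-parallel square.
  set f : Plane →ₗ[ℝ] Plane := Matrix.toLin b b !![v 1, -v 0; -u 1, u 0] with hf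
  have hdet : LinearMap.det f = cross u v := by
    rw [hf, LinearMap.det_toLin, Matrix.det_fin_two_of]
    unfold cross
    ring
  have hf0 : ∀ q, f q 0 = cross q v := by
    intro q
    rw [hf, Matrix.toLin_apply]
    simp [hb, Fin.sum_univ_two, Matrix.mulVec, dotProduct, cross]
    ring
  have hf1 : ∀ q, f q 1 = cross u q := by
    intro q
    rw [hf, Matrix.toLin_apply]
    simp [hb, Fin.sum_univ_two, Matrix.mulVec, dotProduct, cross]
    ring
  have hset : openParallelogram p u v = (fun q => -p + q) ⁻¹' (f ⁻¹'
      {q : Plane | q 0 ∈ Set.Ioo (-|cross u v|) |cross u v| ∧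
        q 1 ∈ Set.Ioo (-|cross u v|) |cross u v|}) := by
    ext q
    simp only [openParallelogram, Set.mem_preimage, Set.mem_ofPred_eq, hf0, hf1, Set.mem_Ioo, abs_lt,
      neg_add_eq_sub]
  have hDpos : 0 < |cross u v| := abs_pos.mpr hD
  rw [hset, measure_preimage_add, Measure.addHaar_preimage_linearMap _ (by rw [hdet]; exact hD),
    volume_rectangle, hdet, Real.volume_Ioo, ← ENNReal.ofReal_mul (by linarith),
    ← ENNReal.ofReal_mul (by positivity), abs_inv]
  congr 1
  field_simp
  ring

/-- The corners are `a` and the midpoints of the sides of the triangle `abc`: the barycentric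
weights at `b` and `c` lie in `(0, 1/2)`, which leaves a positive weight at `a`. Half of the
triangle's area is kept. -/
theorem openParallelogram_subset_of_convex {H : Set Plane} (hH : Convex ℝ H) {a b c : Plane}
    (ha : a ∈ H) (hb : b ∈ H) (hc : c ∈ H) :
    openParallelogram (a + (1 / 4 : ℝ) • (b - a) + (1 / 4 : ℝ) • (c - a))
      ((1 / 4 : ℝ) • (b - a)) ((1 / 4 : ℝ) • (c - a)) ⊆ H := by
  rintro q ⟨h1, h2⟩
  set D := cross (b - a) (c - a) with hD
  have e0 : cross ((1 / 4 : ℝ) • (b - a)) ((1 / 4 : ℝ) • (c - a)) = D / 16 := by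
    simp [hD, cross]; ring
  have e1 : cross (q - (a + (1 / 4 : ℝ) • (b - a) + (1 / 4 : ℝ) • (c - a)))
      ((1 / 4 : ℝ) • (c - a)) = cross (q - a) (c - a) / 4 - D / 16 := by
    simp [hD, cross]; ring
  have e2 : cross ((1 / 4 : ℝ) • (b - a)) (q - (a + (1 / 4 : ℝ) • (b - a) + (1 / 4 : ℝ) • (c - a)))
       = cross (b - a) (q - a) / 4 - D / 16 := by
    simp [hD, cross]; ring
  rw [e0, e1] at h1
  rw [e0, e2] at h2
  have hD0 : D ≠ 0 := by
    rintro h0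
    rw [h0] at h1
    simp only [zero_div, sub_zero, abs_zero] at h1
    exact absurd h1 (not_lt.mpr (abs_nonneg _))
  have key : ∀ x : ℝ, |x / 4 - D / 16| < |D / 16| → 0 < x / D ∧ x / D < 1 / 2 := by
    intro x hx
    have : |4 * (x / D) - 1| < 1 := by
      rw [show x / 4 - D / 16 = (4 * (x / D) - 1) * (D / 16) by field_simp; ring, abs_mul] at hx
      have : 0 < |D / 16| := by positivity
      nlinarith
    rw [abs_lt] at this
    constructor <;> linarith
  obtain ⟨s0, s1⟩ := key _ h1
  obtain ⟨t0, t1⟩ := key _ h2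
  set s := cross (q - a) (c - a) / D with hs
  set t := cross (b - a) (q - a) / D with ht
  have hq : q = (1 - s - t) • a + s • b + t • c := by
    have hsD : s * D = cross (q - a) (c - a) := by rw [hs]; field_simp
    have htD : t * D = cross (b - a) (q - a) := by rw [ht]; field_simp
    apply plane_ext <;> apply mul_right_cancel₀ hD0
    · simp only [PiLp.add_apply, PiLp.smul_apply, smul_eq_mul]
      have : ((1 - s - t) * a 0 + s * b 0 + t * c 0) * D
        = a 0 * D + (s * D) * (b 0 - a 0) + (t * D) * (c 0 - a 0) := by ring
      rw [this, hsD, htD, hD]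
      simp [cross]; ring
    · simp only [PiLp.add_apply, PiLp.smul_apply, smul_eq_mul]
      have : ((1 - s - t) * a 1 + s * b 1 + t * c 1) * D
        = a 1 * D + (s * D) * (b 1 - a 1) + (t * D) * (c 1 - a 1) := by ring
      rw [this, hsD, htD, hD]
      simp [cross]; ring
  rw [hq]
  have := hH.sum_mem (t := Finset.univ) (w := ![1 - s - t, s, t]) (z := ![a, b, c])
    (by intro i _; fin_cases i <;> simp <;> linarith)
    (by simp [Fin.sum_univ_three]; ring)
    (by intro i _; fin_cases i <;> simpa)
  simpa [Fin.sum_univ_three] using this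

/-- A bounded convex set of positive area contains a parallelogram of comparable area. -/
theorem exists_openParallelogram_subset {H : Set Plane} (hH : Convex ℝ H)
    (hint : (interior H).Nonempty) {R : ℝ} (hR : ∀ q ∈ H, ∀ i, |q i| ≤ R) :
    ∃ p u v : Plane, (∀ i, |p i| ≤ R) ∧ (∀ i, |u i| ≤ R) ∧ (∀ i, |v i| ≤ R) ∧
      openParallelogram p u v ⊆ H ∧ volume H ≤ ENNReal.ofReal (256 * |cross u v|) := by
  set S : Set ℝ := {d | ∃ a ∈ H, ∃ b ∈ H, ∃ c ∈ H, d = |cross (b - a) (c - a)|} with hS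
  have hbdd : BddAbove S := by
    refine ⟨8 * R ^ 2, ?_⟩
    rintro d ⟨a, ha, b, hb, c, hc, rfl⟩
    have hdiff : ∀ x ∈ H, ∀ i, |x i - a i| ≤ 2 * R := fun x hx i =>
      (abs_sub _ _).trans (by linarith [hR x hx i, hR a ha i])
    have hR0 : 0 ≤ R := (abs_nonneg _).trans (hR a ha 0)
    have hm : ∀ i j, |(b i - a i) * (c j - a j)| ≤ (2 * R) * (2 * R) := fun i j => by
      rw [abs_mul]
      exact mul_le_mul (hdiff b hb i) (hdiff c hc j) (abs_nonneg _) (by linarith)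
    refine (abs_sub _ _).trans ?_
    have h1 := hm 0 1
    have h2 := hm 1 0
    simp only [PiLp.sub_apply]
    linarith
  obtain ⟨z, hz⟩ := hint
  have hpos : 0 < sSup S := by
    obtain ⟨ε, hε, hball⟩ := Metric.isOpen_iff.mp isOpen_interior z hz
    have hmem : ∀ i : Fin 2, z + (ε / 2) • EuclideanSpace.single i (1 : ℝ) ∈ H := fun i =>
      interior_subset (hball (by
        rw [Metric.mem_ball, dist_self_add_left, norm_smul]
        simp [abs_of_pos hε]
        linarith))
    have hd : (ε / 2) ^ 2 ∈ S :=
      ⟨z, interior_subset hz, _, hmem 0, _, hmem 1, by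
        simp [cross]
        ring⟩
    exact lt_of_lt_of_le (by positivity) (le_csSup hbdd hd)
  have hne : S.Nonempty := ⟨_, z, interior_subset hz, z, interior_subset hz, z,
    interior_subset hz, rfl⟩
  -- `H` need not be closed, so the largest determinant may not be attained; a triangle within a
  -- factor 2 of it is enough. Then `H` has coordinates below 2 in the frame at `a`, so its area is
  -- at most `16 |D|`, against an inscribed determinant of `|D| / 16`: hence 256.
  obtain ⟨D, ⟨a, ha, b, hb, c, hc, rfl⟩, hD⟩ := exists_lt_of_lt_csSup hne (half_lt_self hpos)
  have hle : ∀ x ∈ H, ∀ y ∈ H, |cross (x - a) (y - a)| < 2 * |cross (b - a) (c - a)| :=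
    fun x hx y hy =>
      lt_of_le_of_lt (le_csSup hbdd ⟨a, ha, x, hx, y, hy, rfl⟩) (by linarith)
  have hsub : H ⊆ openParallelogram a ((2 : ℝ) • (b - a)) ((2 : ℝ) • (c - a)) := by
    intro q hq
    have h1 := hle q hq c hc
    have h2 := hle b hb q hq
    have e0 : cross ((2 : ℝ) • (b - a)) ((2 : ℝ) • (c - a)) = 4 * cross (b - a) (c - a) := by
      simp [cross]; ring
    have e1 : cross (q - a) ((2 : ℝ) • (c - a)) = 2 * cross (q - a) (c - a) := by
      simp [cross]; ring
    have e2 : cross ((2 : ℝ) • (b - a)) (q - a) = 2 * cross (b - a) (q - a) := by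
      simp [cross]; ring
    constructor
    · rw [e0, e1, abs_mul, abs_mul]; norm_num; linarith
    · rw [e0, e2, abs_mul, abs_mul]; norm_num; linarith
  have hdiff : ∀ x ∈ H, ∀ i, |((1 / 4 : ℝ) • (x - a)) i| ≤ R := fun x hx i => by
    have h1 := abs_le.mp (hR x hx i)
    have h2 := abs_le.mp (hR a ha i)
    simp only [PiLp.smul_apply, PiLp.sub_apply, smul_eq_mul, abs_le]
    constructor <;> linarith
  refine ⟨_, _, _, fun i => ?_, hdiff b hb, hdiff c hc,
    openParallelogram_subset_of_convex hH ha hb hc, (measure_mono hsub).trans ?_⟩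
  · have h1 := abs_le.mp (hR a ha i)
    have h2 := abs_le.mp (hR b hb i)
    have h3 := abs_le.mp (hR c hc i)
    simp only [PiLp.add_apply, PiLp.smul_apply, PiLp.sub_apply, smul_eq_mul, abs_le]
    constructor <;> linarith
  · rw [volume_openParallelogram]
    apply ENNReal.ofReal_le_ofReal
    have e0 : cross ((2 : ℝ) • (b - a)) ((2 : ℝ) • (c - a)) = 4 * cross (b - a) (c - a) := by
      simp [cross]; ring
    have e1 : cross ((1 / 4 : ℝ) • (b - a)) ((1 / 4 : ℝ) • (c - a)) =
        (1 / 16) * cross (b - a) (c - a) := by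
      simp [cross]; ring
    rw [e0, e1, abs_mul, abs_mul]
    norm_num
    linarith

/-- A parallelogram contains every parallelogram with half the sides, after a small
perturbation. -/
theorem openParallelogram_perturb {p u v p' u' v' : Plane} {R δ : ℝ} (hδ : 0 ≤ δ) (hδR : δ ≤ R)
    (hu : ∀ i, |u i| ≤ R) (hv : ∀ i, |v i| ≤ R) (hp' : ∀ i, |p' i - p i| ≤ δ)
    (hu' : ∀ i, |u' i - u i / 2| ≤ δ) (hv' : ∀ i, |v' i - v i / 2| ≤ δ)
    (hD : 32 * R * δ ≤ |cross u v|) :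
    openParallelogram p' u' v' ⊆ openParallelogram p u v ∧ |cross u v| / 8 ≤ |cross u' v'| := by
  have hR : 0 ≤ R := hδ.trans hδR
  have hmul : ∀ x y X Y : ℝ, |x| ≤ X → |y| ≤ Y → |x * y| ≤ X * Y := fun x y X Y hx hy => by
    rw [abs_mul]
    exact mul_le_mul hx hy (abs_nonneg _) ((abs_nonneg _).trans hx)
  have hcross : ∀ x y : Plane, ∀ X Y : ℝ, (∀ i, |x i| ≤ X) → (∀ i, |y i| ≤ Y) →
      |cross x y| ≤ 2 * (X * Y) := fun x y X Y hx hy => by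
    refine (abs_sub _ _).trans ?_
    have h1 := hmul _ _ _ _ (hx 0) (hy 1)
    have h2 := hmul _ _ _ _ (hx 1) (hy 0)
    linarith
  set e : Plane := u' - (1 / 2 : ℝ) • u with he
  set f : Plane := v' - (1 / 2 : ℝ) • v with hf
  set g : Plane := p' - p with hg
  have he' : ∀ i, |e i| ≤ δ := fun i => by
    simpa [he, div_eq_inv_mul] using hu' i
  have hf' : ∀ i, |f i| ≤ δ := fun i => by
    simpa [hf, div_eq_inv_mul] using hv' i
  have hg' : ∀ i, |g i| ≤ δ := fun i => by
    simpa [hg] using hp' i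
  have hD' : cross u' v' = cross u v / 4 + (cross u f / 2 + cross e v / 2 + cross e f) := by
    simp [he, hf, cross]; ring
  have h1 := abs_le.mp (hcross u f R δ hu hf')
  have h2 := abs_le.mp (hcross e v δ R he' hv)
  have h3 := abs_le.mp (hcross e f δ δ he' hf')
  have hδδ : δ * δ ≤ R * δ := mul_le_mul_of_nonneg_right hδR hδ
  -- The factor 32 in `hD` is chosen here: an error of `4 * R * δ` is at most `|cross u v| / 8`,
  -- half of the main term `|cross u v| / 4`.
  have hrest : |cross u f / 2 + cross e v / 2 + cross e f| ≤ 4 * R * δ := by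
    rw [abs_le]; constructor <;> nlinarith
  have hlow : |cross u v| / 8 ≤ |cross u' v'| := by
    have := abs_sub_abs_le_abs_sub (cross u v / 4) (-(cross u f / 2 + cross e v / 2 + cross e f))
    rw [sub_neg_eq_add, ← hD', abs_neg, abs_div, abs_of_pos (by norm_num : (0 : ℝ) < 4)] at this
    linarith
  refine ⟨?_, hlow⟩
  rintro q ⟨k1, k2⟩
  have hD0 : cross u' v' ≠ 0 := by
    rintro h0
    rw [h0, abs_zero] at k1
    exact absurd k1 (not_lt.mpr (abs_nonneg _))
  set D := cross u' v' with hDdef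
  set s := cross (q - p') v' / D with hs
  set t := cross u' (q - p') / D with ht
  have hsD : s * D = cross (q - p') v' := by rw [hs]; field_simp
  have htD : t * D = cross u' (q - p') := by rw [ht]; field_simp
  have hlt1 : ∀ x : ℝ, |x * D| < |D| → |x| ≤ 1 := by
    intro x hx
    rw [abs_mul] at hx
    have : 0 < |D| := abs_pos.mpr hD0
    nlinarith
  have hs1 : |s| ≤ 1 := hlt1 s (by rw [hsD]; exact k1)
  have ht1 : |t| ≤ 1 := hlt1 t (by rw [htD]; exact k2)
  have hq : q - p = (s / 2) • u + (t / 2) • v + (g + s • e + t • f) := by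
    have hq' : q - p' = s • u' + t • v' := by
      apply plane_ext <;> apply mul_right_cancel₀ hD0
      · simp only [PiLp.add_apply, PiLp.sub_apply, PiLp.smul_apply, smul_eq_mul]
        rw [show (s * u' 0 + t * v' 0) * D = (s * D) * u' 0 + (t * D) * v' 0 by ring, hsD, htD,
          hDdef]
        simp [cross]; ring
      · simp only [PiLp.add_apply, PiLp.sub_apply, PiLp.smul_apply, smul_eq_mul]
        rw [show (s * u' 1 + t * v' 1) * D = (s * D) * u' 1 + (t * D) * v' 1 by ring, hsD, htD,
          hDdef]
        simp [cross]; ring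
    rw [show q - p = (q - p') + (p' - p) by abel, hq', he, hf, hg]
    module
  set w : Plane := g + s • e + t • f with hw
  have hw' : ∀ i, |w i| ≤ 3 * δ := fun i => by
    have a1 := abs_le.mp (hmul _ _ _ _ hs1 (he' i))
    have a2 := abs_le.mp (hmul _ _ _ _ ht1 (hf' i))
    have a3 := abs_le.mp (hg' i)
    simp only [hw, PiLp.add_apply, PiLp.smul_apply, smul_eq_mul, abs_le]
    constructor <;> linarith
  have c1 := hcross w v _ _ hw' hv
  have c2 := hcross u w _ _ hu hw'
  have hpos : 0 < |cross u v| := by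
    by_contra hcon
    have hz : |cross u v| = 0 := le_antisymm (not_lt.mp hcon) (abs_nonneg _)
    have hRδ : R * δ = 0 := le_antisymm (by linarith) (by positivity)
    have huv : cross u v = 0 := abs_eq_zero.mp hz
    apply hD0
    rw [hD', huv]
    have : |cross u f / 2 + cross e v / 2 + cross e f| = 0 :=
      le_antisymm (by linarith) (abs_nonneg _)
    rw [abs_eq_zero.mp this]; norm_num
  constructor
  · rw [show cross (q - p) v = s / 2 * cross u v + cross w v by rw [hq]; simp [cross]; ring]
    refine lt_of_le_of_lt (abs_add_le _ _) ?_
    rw [abs_mul, abs_div, abs_of_pos (by norm_num : (0 : ℝ) < 2)]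
    nlinarith
  · rw [show cross u (q - p) = t / 2 * cross u v + cross u w by rw [hq]; simp [cross]; ring]
    refine lt_of_le_of_lt (abs_add_le _ _) ?_
    rw [abs_mul, abs_div, abs_of_pos (by norm_num : (0 : ℝ) < 2)]
    nlinarith

/-! ### The probability that the points avoid a set -/

/-- The event that none of the `n` points lies in `V`. -/
def avoid (n : ℕ) (V : Set Plane) : Set (Fin n → Plane) := {x | ∀ i, x i ∉ V}

theorem avoid_eq_pi (n : ℕ) (V : Set Plane) : avoid n V = Set.univ.pi fun _ => Vᶜ := by
  ext x
  simp only [avoid, Set.mem_ofPred_eq, Set.mem_pi, Set.mem_univ, true_implies, Set.mem_compl_iff]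

theorem measurableSet_avoid (n : ℕ) {V : Set Plane} (hV : MeasurableSet V) :
    MeasurableSet (avoid n V) := by
  rw [avoid_eq_pi]
  exact MeasurableSet.univ_pi fun _ => hV.compl

theorem avoid_inter_avoid (n : ℕ) (V W : Set Plane) :
    avoid n V ∩ avoid n W = avoid n (V ∪ W) := by
  ext x
  simp only [avoid, Set.mem_inter_iff, Set.mem_ofPred_eq, Set.mem_union, not_or, forall_and]

theorem isProbabilityMeasure_cond {K : Set Plane} (hK1 : volume K = 1) :
    IsProbabilityMeasure (ProbabilityTheory.cond volume K) := by
  constructor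
  simp [ProbabilityTheory.cond, hK1]

theorem isProbabilityMeasure_uniformPoints {K : Set Plane} (hK1 : volume K = 1) (n : ℕ) :
    IsProbabilityMeasure (uniformPoints K n) := by
  have := isProbabilityMeasure_cond hK1
  unfold uniformPoints
  infer_instance

theorem uniformPoints_avoid {K : Set Plane} (hK1 : volume K = 1) (n : ℕ) {V : Set Plane}
    (hV : MeasurableSet V) (hVK : V ⊆ K) :
    uniformPoints K n (avoid n V) = (1 - volume V) ^ n := by
  have := isProbabilityMeasure_cond hK1
  unfold uniformPoints
  rw [avoid_eq_pi, Measure.pi_pi, Finset.prod_const, Finset.card_univ, Fintype.card_fin,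
    prob_compl_eq_one_sub hV]
  congr 2
  rw [ProbabilityTheory.cond, Measure.smul_apply, Measure.restrict_apply hV, hK1,
    Set.inter_eq_left.mpr hVK]
  simp

theorem uniformPoints_avoid_eq_ofReal {K : Set Plane} (hK1 : volume K = 1) (n : ℕ) {V : Set Plane}
    (hV : MeasurableSet V) (hVK : V ⊆ K) {y : ℝ} (hy : 0 ≤ y)
    (hVy : volume V = ENNReal.ofReal y) :
    y ≤ 1 ∧ uniformPoints K n (avoid n V) = ENNReal.ofReal ((1 - y) ^ n) := by
  have hy1 : y ≤ 1 := by
    have := measure_mono (μ := volume) hVK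
    rwa [hVy, hK1, ENNReal.ofReal_le_one] at this
  refine ⟨hy1, ?_⟩
  rw [uniformPoints_avoid hK1 n hV hVK, hVy, ENNReal.ofReal_pow (by linarith),
    ENNReal.ofReal_sub _ hy, ENNReal.ofReal_one]

/-! ### Convex sets of finite area: null or bounded -/

/-- With empty interior, a convex set lies in its own frontier, which is null. -/
theorem Convex.volume_eq_zero_of_interior_eq_empty {C : Set Plane} (hC : Convex ℝ C)
    (h : interior C = ∅) : volume C = 0 := by
  refine measure_mono_null ?_ (hC.addHaar_frontier volume)
  rw [frontier, h, Set.sdiff_empty]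
  exact subset_closure

/-- A convex set of finite area with nonempty interior is bounded. -/
theorem Convex.exists_coord_bound {C : Set Plane} (hC : Convex ℝ C) (hint : (interior C).Nonempty)
    (hvol : volume C ≠ ⊤) : ∃ R : ℝ, ∀ q ∈ C, ∀ i, |q i| ≤ R := by
  obtain ⟨z, hz⟩ := hint
  obtain ⟨ε, hε, hball⟩ := Metric.isOpen_iff.mp isOpen_interior z hz
  have hmem : ∀ i : Fin 2, z + (ε / 2) • EuclideanSpace.single i (1 : ℝ) ∈ C := fun i =>
    interior_subset (hball (by
      rw [Metric.mem_ball, dist_self_add_left, norm_smul]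
      simp [abs_of_pos hε]
      linarith))
  set A := (volume C).toReal with hA
  have key : ∀ q ∈ C, ∀ c ∈ C, |cross (q - z) (c - z)| / 4 ≤ A := by
    intro q hq c hc
    have h := measure_mono (μ := volume)
      (openParallelogram_subset_of_convex hC (interior_subset hz) hq hc)
    rw [volume_openParallelogram, ENNReal.ofReal_le_iff_le_toReal hvol] at h
    have e1 : cross ((1 / 4 : ℝ) • (q - z)) ((1 / 4 : ℝ) • (c - z)) =
        (1 / 16) * cross (q - z) (c - z) := by
      simp [cross]; ring
    rw [e1, abs_mul, abs_of_pos (by norm_num : (0 : ℝ) < 1 / 16)] at h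
    linarith
  -- Pairing `q - z` with `(ε / 2)` times a basis vector isolates the other coordinate, up to sign.
  have hcoord : ∀ q ∈ C, ∀ i, |q i - z i| ≤ 8 * A / ε := by
    intro q hq i
    rw [le_div_iff₀ hε]
    have h0 := key q hq _ (hmem 0)
    have h1 := key q hq _ (hmem 1)
    simp only [cross, add_sub_cancel_left] at h0 h1
    simp [abs_mul] at h0 h1
    rw [abs_of_pos (half_pos hε)] at h0 h1
    fin_cases i
    · simp only [Fin.zero_eta]; linarith
    · simp only [Fin.mk_one]; linarith
  refine ⟨8 * A / ε + (|z 0| + |z 1|), fun q hq i => ?_⟩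
  have h1 := hcoord q hq i
  have h2 : |z i| ≤ |z 0| + |z 1| := by
    fin_cases i
    · simp
    · simp
  have h3 := abs_add_le (q i - z i) (z i)
  rw [sub_add_cancel] at h3
  linarith

/-- Full-dimensional convex subsets of a finite union of convex sets of finite area are uniformly
bounded. -/
theorem IsFiniteUnionOfConvex.exists_coord_bound {K : Set Plane} (hK : IsFiniteUnionOfConvex K)
    (hK1 : volume K ≠ ⊤) :
    ∃ R : ℝ, 1 ≤ R ∧ ∀ H ⊆ K, Convex ℝ H → (interior H).Nonempty → ∀ q ∈ H, ∀ i, |q i| ≤ R := by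
  obtain ⟨m, C, hC, rfl⟩ := hK
  have hex : ∀ j, ∃ R : ℝ, (interior (C j)).Nonempty → ∀ q ∈ C j, ∀ i, |q i| ≤ R := by
    intro j
    by_cases hj : (interior (C j)).Nonempty
    · obtain ⟨R, hR⟩ := (hC j).exists_coord_bound hj
        (ne_top_of_le_ne_top hK1 (measure_mono (Set.subset_iUnion C j)))
      exact ⟨R, fun _ => hR⟩
    · exact ⟨0, fun h => absurd h hj⟩
  choose f hf using hex
  obtain ⟨M, hM⟩ := (Set.finite_range f).bddAbove
  refine ⟨max 1 M, le_max_left _ _, fun H hHK hH hint => ?_⟩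
  set B : Set Plane := {q | ∀ i, |q i| ≤ max 1 M} with hB
  have hBclosed : IsClosed B := by
    rw [hB, show {q : Plane | ∀ i, |q i| ≤ max 1 M} = ⋂ i, {q : Plane | |q i| ≤ max 1 M} by
      ext; simp]
    exact isClosed_iInter fun i => isClosed_le (continuous_plane_coord i).abs continuous_const
  -- Pieces with empty interior may be unbounded but are null. So the part of `interior H` outside
  -- `B` is open and null, hence empty, and `H` lies in the closure of its interior.
  have hnull : volume (interior H \ B) = 0 := by
    refine measure_mono_null (t := ⋃ j ∈ {j | interior (C j) = ∅}, C j) ?_ ?_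
    · rintro q ⟨hq, hqB⟩
      obtain ⟨j, hj⟩ := Set.mem_iUnion.mp (hHK (interior_subset hq))
      refine Set.mem_biUnion (x := j) ?_ hj
      by_contra hne
      exact hqB fun i => (hf j (Set.nonempty_iff_ne_empty.mpr hne) q hj i).trans
        ((hM ⟨j, rfl⟩).trans (le_max_right _ _))
    · rw [measure_biUnion_null_iff (Set.to_countable _)]
      exact fun j hj => (hC j).volume_eq_zero_of_interior_eq_empty hj
  have hempty : interior H \ B = ∅ :=
    (isOpen_interior.sdiff hBclosed).measure_eq_zero_iff volume |>.mp hnull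
  have hsub : H ⊆ B := subset_closure.trans <| by
    rw [← hH.closure_interior_eq_closure_of_nonempty_interior hint]
    exact closure_minimal (Set.sdiff_eq_empty.mp hempty) hBclosed
  exact fun q hq => hsub hq

theorem IsFiniteUnionOfConvex.interior_nonempty {K : Set Plane} (hK : IsFiniteUnionOfConvex K)
    (hK0 : volume K ≠ 0) : (interior K).Nonempty := by
  obtain ⟨m, C, hC, rfl⟩ := hK
  by_contra h
  apply hK0
  rw [measure_iUnion_null_iff]
  intro j
  apply (hC j).volume_eq_zero_of_interior_eq_empty
  rw [Set.not_nonempty_iff_eq_empty] at h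
  exact Set.subset_empty_iff.mp (h ▸ interior_mono (Set.subset_iUnion C j))

/-! ### Upper bound: a union bound over lattice parallelograms -/

/-- The point of the lattice `(1 / N) ℤ²` with integer coordinates `a` and `b`. -/
noncomputable def latticePoint (N : ℝ) (a b : ℤ) : Plane := !₂[(a : ℝ) / N, (b : ℝ) / N]

/-- The parallelogram given by three points of the lattice `(1 / N) ℤ²`. -/
noncomputable def latticeParallelogram (N : ℝ) (a : Fin 6 → ℤ) : Set Plane :=
  openParallelogram (latticePoint N (a 0) (a 1)) (latticePoint N (a 2) (a 3))
    (latticePoint N (a 4) (a 5))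

theorem abs_round_div_sub_le {N : ℝ} (hN : 0 < N) (x : ℝ) : |(round (x * N) : ℝ) / N - x| ≤ 1 / N := by
  rw [show (round (x * N) : ℝ) / N - x = (round (x * N) - x * N) / N by field_simp, abs_div,
    abs_of_pos hN]
  have := abs_sub_round (x * N)
  rw [abs_sub_comm] at this
  gcongr
  linarith

theorem uniformPoints_avoid_openParallelogram_le {K : Set Plane} (hK1 : volume K = 1) (n : ℕ)
    {p u v : Plane} (h : openParallelogram p u v ⊆ K) :
    uniformPoints K n (avoid n (openParallelogram p u v)) ≤
      ENNReal.ofReal (Real.exp (-(n * (4 * |cross u v|)))) := by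
  obtain ⟨h1, h2⟩ := uniformPoints_avoid_eq_ofReal hK1 n
    (isOpen_openParallelogram p u v).measurableSet h (by positivity)
    (volume_openParallelogram p u v)
  rw [h2]
  apply ENNReal.ofReal_le_ofReal
  rw [show -((n : ℝ) * (4 * |cross u v|)) = n * (-(4 * |cross u v|)) by ring, Real.exp_nat_mul]
  exact pow_le_pow_left₀ (by linarith) (Real.one_sub_le_exp_neg _) n

/-- With high probability there is no convex hole of area more than `12800 * log n / n`. -/
theorem tendsto_large_convex_hole {K : Set Plane} (hK : IsFiniteUnionOfConvex K)
    (hK1 : volume K = 1) :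
    Tendsto (fun n : ℕ => uniformPoints K n
      {x | ∃ H, (IsHole K x H ∧ Convex ℝ H) ∧
        ENNReal.ofReal (12800 * (Real.log n / n)) < volume H}) atTop (𝓝 0) := by
  classical
  obtain ⟨R, hR1, hR⟩ := hK.exists_coord_bound (by rw [hK1]; exact ENNReal.one_ne_top)
  have hbound : ∀ᶠ n : ℕ in atTop, uniformPoints K n
      {x | ∃ H, (IsHole K x H ∧ Convex ℝ H) ∧
        ENNReal.ofReal (12800 * (Real.log n / n)) < volume H} ≤ ENNReal.ofReal (1 / n) := by
    filter_upwards [eventually_ge_atTop 3, eventually_ge_atTop ⌈32 * R⌉₊] with n hn3 hnR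
    have hnR' : 32 * R ≤ n := Nat.ceil_le.mp hnR
    have hn3' : (3 : ℝ) ≤ n := by exact_mod_cast hn3
    have hn0 : (0 : ℝ) < n := by linarith
    have hlog : 1 ≤ Real.log n := by
      rw [Real.le_log_iff_exp_le hn0]
      linarith [Real.exp_one_lt_d9]
    set N : ℝ := (n : ℝ) ^ 2 with hN
    have hN0 : 0 < N := by positivity
    set I : Finset ℤ := Finset.Icc (-(n : ℤ) ^ 3) ((n : ℤ) ^ 3) with hI
    -- At most `(2 n³ + 1)⁶ ≤ n²⁴` candidates, each avoided with probability at most `n⁻²⁵`: the 25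
    -- makes the sum at most `1 / n`.
    set G : Finset (Fin 6 → ℤ) := (Fintype.piFinset fun _ => I).filter fun a =>
      latticeParallelogram N a ⊆ K ∧
        25 * (Real.log n / n) ≤ 4 * |cross (latticePoint N (a 2) (a 3)) (latticePoint N (a 4) (a 5))|
      with hG
    have hround : ∀ x : ℝ, |x| ≤ R → round (x * N) ∈ I := by
      intro x hx
      have h1 := abs_sub_round (x * N)
      have h2 : |x * N| ≤ R * N := by
        rw [abs_mul, abs_of_pos hN0]
        exact mul_le_mul_of_nonneg_right hx hN0.le
      have h3 : |(round (x * N) : ℝ)| ≤ (n : ℝ) ^ 3 := by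
        have h4 : R * N + 1 ≤ (n : ℝ) ^ 3 := by rw [hN]; nlinarith
        rw [abs_le] at h1 h2 ⊢
        constructor <;> linarith
      rw [abs_le] at h3
      rw [hI, Finset.mem_Icc]
      exact ⟨by exact_mod_cast h3.1, by exact_mod_cast h3.2⟩
    have hcover : {x | ∃ H, (IsHole K x H ∧ Convex ℝ H) ∧
        ENNReal.ofReal (12800 * (Real.log n / n)) < volume H} ⊆
        ⋃ a ∈ G, avoid n (latticeParallelogram N a) := by
      rintro x ⟨H, ⟨⟨hHK, hx⟩, hH⟩, hvol⟩
      have hint : (interior H).Nonempty := by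
        rw [Set.nonempty_iff_ne_empty]
        intro h
        rw [hH.volume_eq_zero_of_interior_eq_empty h] at hvol
        exact not_lt_bot hvol
      obtain ⟨p, u, v, hp, hu, hv, hsub, hle⟩ :=
        exists_openParallelogram_subset hH hint (hR H hHK hH hint)
      -- 12800 = 25 * 512: a factor 256 is lost on inscribing, 8 on rounding, and 4 is regained from
      -- area `4 * |cross|`.
      have hbig : 12800 * (Real.log n / n) < 256 * |cross u v| :=
        (ENNReal.ofReal_lt_ofReal_iff_of_nonneg (by positivity)).mp (hvol.trans_le hle)
      have hinv : 1 / (n : ℝ) ≤ Real.log n / n := by gcongr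
      set a : Fin 6 → ℤ := ![round (p 0 * N), round (p 1 * N), round (u 0 / 2 * N),
        round (u 1 / 2 * N), round (v 0 / 2 * N), round (v 1 / 2 * N)] with ha
      have hhalf : ∀ x : ℝ, |x| ≤ R → |x / 2| ≤ R := fun x hx => by
        rw [abs_le] at hx ⊢
        constructor <;> linarith
      obtain ⟨k1, k2⟩ := openParallelogram_perturb (p := p) (u := u) (v := v)
        (p' := latticePoint N (a 0) (a 1)) (u' := latticePoint N (a 2) (a 3))
        (v' := latticePoint N (a 4) (a 5)) (R := R) (δ := 1 / N) (by positivity)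
        (by
          rw [div_le_iff₀ hN0, hN]
          nlinarith) hu hv
        (by intro i; fin_cases i <;> exact abs_round_div_sub_le hN0 _)
        (by intro i; fin_cases i <;> exact abs_round_div_sub_le hN0 _)
        (by intro i; fin_cases i <;> exact abs_round_div_sub_le hN0 _)
        (by
          have h1 : 32 * R * (1 / N) ≤ 1 / n := by
            rw [hN, mul_one_div, div_le_div_iff₀ (by positivity) hn0]
            nlinarith
          have h2 : 0 ≤ 1 / (n : ℝ) := by positivity
          linarith)
      have haG : a ∈ G := by
        rw [hG, Finset.mem_filter, Fintype.mem_piFinset]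
        refine ⟨fun i => ?_, k1.trans (hsub.trans hHK), by linarith⟩
        fin_cases i
        · exact hround _ (hp 0)
        · exact hround _ (hp 1)
        · exact hround _ (hhalf _ (hu 0))
        · exact hround _ (hhalf _ (hu 1))
        · exact hround _ (hhalf _ (hv 0))
        · exact hround _ (hhalf _ (hv 1))
      refine Set.mem_biUnion (x := a) haG fun i hi => hx i ?_
      exact interior_maximal (k1.trans hsub) (isOpen_openParallelogram _ _ _) hi
    refine (measure_mono hcover).trans ((measure_biUnion_finset_le _ _).trans ?_)
    have hterm : ∀ a ∈ G, uniformPoints K n (avoid n (latticeParallelogram N a)) ≤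
        ENNReal.ofReal (1 / (n : ℝ) ^ 25) := by
      intro a ha
      rw [hG, Finset.mem_filter] at ha
      refine (uniformPoints_avoid_openParallelogram_le hK1 n ha.2.1).trans ?_
      apply ENNReal.ofReal_le_ofReal
      rw [one_div, ← Real.exp_log (show 0 < (n : ℝ) ^ 25 by positivity), ← Real.exp_neg,
        Real.exp_le_exp, Real.log_pow, neg_le_neg_iff]
      have := mul_le_mul_of_nonneg_left ha.2.2 hn0.le
      rw [show (n : ℝ) * (25 * (Real.log n / n)) = 25 * Real.log n by field_simp] at this
      exact_mod_cast this
    refine (Finset.sum_le_sum hterm).trans ?_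
    rw [Finset.sum_const, nsmul_eq_mul, ← ENNReal.ofReal_natCast, ← ENNReal.ofReal_mul (by positivity)]
    apply ENNReal.ofReal_le_ofReal
    have hcard : (G.card : ℝ) ≤ (n : ℝ) ^ 24 := by
      have h1 : G.card ≤ I.card ^ 6 := by
        refine (Finset.card_filter_le _ _).trans ?_
        rw [Fintype.card_piFinset_const]
      have h2 : I.card ≤ n ^ 4 := by
        have h5 : 2 * n ^ 3 + 1 ≤ n ^ 4 := by
          have : 1 ≤ n ^ 3 := Nat.one_le_pow _ _ (by omega)
          calc 2 * n ^ 3 + 1 ≤ 3 * n ^ 3 := by omega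
            _ ≤ n * n ^ 3 := Nat.mul_le_mul_right _ hn3
            _ = n ^ 4 := by ring
        rw [hI, Int.card_Icc]
        refine le_trans (le_of_eq ?_) h5
        rw [show (n : ℤ) ^ 3 + 1 - -(n : ℤ) ^ 3 = ((2 * n ^ 3 + 1 : ℕ) : ℤ) by push_cast; ring]
        exact Int.toNat_natCast _
      have h3 : G.card ≤ n ^ 24 := h1.trans ((Nat.pow_le_pow_left h2 6).trans (by rw [← pow_mul]))
      exact_mod_cast h3
    calc (G.card : ℝ) * (1 / (n : ℝ) ^ 25) ≤ (n : ℝ) ^ 24 * (1 / (n : ℝ) ^ 25) := by gcongr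
      _ = 1 / (n : ℝ) := by field_simp
  refine tendsto_of_tendsto_of_tendsto_of_le_of_le' tendsto_const_nhds ?_
    (Eventually.of_forall fun _ => bot_le) hbound
  rw [← ENNReal.ofReal_zero]
  exact ENNReal.tendsto_ofReal tendsto_one_div_atTop_nhds_zero_nat

/-! ### Second moment method -/

/-- A second moment bound: if the events `C i` have probability `p` and are pairwise nonpositively
correlated, and each `D i` is unlikely given `C i`, then some `C i \ D i` is likely to occur. -/
theorem measureReal_forall_notMem_diff_le {Ω ι : Type*} [MeasurableSpace Ω] (μ : Measure Ω)
    [IsProbabilityMeasure μ] [Fintype ι] [Nonempty ι] {C D : ι → Set Ω}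
    (hC : ∀ i, MeasurableSet (C i)) (hD : ∀ i, MeasurableSet (D i)) {p ε : ℝ} (hp : 0 < p)
    (h1 : ∀ i, μ.real (C i) = p) (h2 : ∀ i j, i ≠ j → μ.real (C i ∩ C j) ≤ p ^ 2)
    (h3 : ∀ i, μ.real (C i ∩ D i) ≤ ε * p) :
    μ.real {ω | ∀ i, ω ∉ C i \ D i} ≤ 1 / (Fintype.card ι * p) + 2 * ε := by
  classical
  set N : ℝ := (Fintype.card ι : ℝ) with hN
  have hN0 : 0 < N := by rw [hN]; exact_mod_cast Fintype.card_pos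
  set m := N * p with hm
  have hm0 : 0 < m := by positivity
  set G : ι → Set Ω := fun i => C i \ D i with hG
  have hGm : ∀ i, MeasurableSet (G i) := fun i => (hC i).diff (hD i)
  set X : Ω → ℝ := fun ω => ∑ i, (G i).indicator 1 ω with hX
  set Y : Ω → ℝ := fun ω => ∑ i, ∑ j, (G i ∩ G j).indicator 1 ω with hY
  have hXX : ∀ ω, X ω ^ 2 = Y ω := by
    intro ω
    simp only [hX, hY]
    rw [sq, Finset.sum_mul_sum]
    refine Finset.sum_congr rfl fun i _ => Finset.sum_congr rfl fun j _ => ?_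
    rw [Set.inter_indicator_one]
    rfl
  have hint : ∀ S : Set Ω, MeasurableSet S → Integrable (S.indicator (1 : Ω → ℝ)) μ :=
    fun S hS => (integrable_const (1 : ℝ)).indicator hS
  have hXint : Integrable X μ := integrable_finsetSum _ fun i _ => hint _ (hGm i)
  have hYint : Integrable Y μ := integrable_finsetSum _ fun i _ =>
    integrable_finsetSum _ fun j _ => hint _ ((hGm i).inter (hGm j))
  have hEX : N * (p * (1 - ε)) ≤ ∫ ω, X ω ∂μ := by
    rw [integral_finsetSum _ fun i _ => hint _ (hGm i)]
    rw [show N * (p * (1 - ε)) = ∑ _i : ι, p * (1 - ε) by simp [hN]]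
    refine Finset.sum_le_sum fun i _ => ?_
    rw [integral_indicator_one (hGm i)]
    have := measureReal_sdiff_add_inter (μ := μ) (s := C i) (hD i)
    rw [h1 i] at this
    have h := h3 i
    simp only [hG]
    linarith
  -- Only the `C i` enter the second moment, since `G i ∩ G j ⊆ C i ∩ C j`; no correlation between
  -- the `D i` is needed.
  have hEY : ∫ ω, Y ω ∂μ ≤ m + m ^ 2 := by
    rw [integral_finsetSum _ fun i _ =>
      integrable_finsetSum _ fun j _ => hint _ ((hGm i).inter (hGm j))]
    have hrow : ∀ i, ∫ ω, ∑ j, (G i ∩ G j).indicator (1 : Ω → ℝ) ω ∂μ ≤ p + N * p ^ 2 := by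
      intro i
      rw [integral_finsetSum _ fun j _ => hint _ ((hGm i).inter (hGm j))]
      have hterm : ∀ j, ∫ ω, (G i ∩ G j).indicator (1 : Ω → ℝ) ω ∂μ ≤
          (if j = i then p else 0) + p ^ 2 := by
        intro j
        rw [integral_indicator_one ((hGm i).inter (hGm j))]
        split_ifs with hij
        · have : μ.real (G i ∩ G j) ≤ μ.real (C i) :=
            measureReal_mono (Set.inter_subset_left.trans Set.sdiff_subset)
          rw [h1 i] at this
          nlinarith
        · have : μ.real (G i ∩ G j) ≤ μ.real (C i ∩ C j) :=
            measureReal_mono (Set.inter_subset_inter Set.sdiff_subset Set.sdiff_subset)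
          rw [zero_add]
          exact this.trans (h2 i j (Ne.symm hij))
      refine (Finset.sum_le_sum fun j _ => hterm j).trans ?_
      rw [Finset.sum_add_distrib]
      simp [hN]
    refine (Finset.sum_le_sum fun i _ => hrow i).trans ?_
    rw [Finset.sum_const, Finset.card_univ, nsmul_eq_mul, hm]
    exact le_of_eq (by rw [← hN]; ring)
  set B : Set Ω := {ω | ∀ i, ω ∉ C i \ D i} with hB
  have hBm : MeasurableSet B := by
    rw [hB, show {ω | ∀ i, ω ∉ C i \ D i} = ⋂ i, (G i)ᶜ by ext; simp [hG]]
    exact MeasurableSet.iInter fun i => (hGm i).compl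
  -- Chebyshev's inequality centred at `m`, the mean of the count of the `C i`: the right side is
  -- `(X / m - 1) ^ 2`, which equals 1 on `B`.
  have hpt : ∀ ω, B.indicator (1 : Ω → ℝ) ω ≤ (1 / m ^ 2 * Y ω - 2 / m * X ω) + 1 := by
    intro ω
    have hsq : (1 / m ^ 2 * Y ω - 2 / m * X ω) + 1 = (X ω / m - 1) ^ 2 := by
      rw [← hXX]; field_simp; ring
    rw [hsq]
    by_cases hω : ω ∈ B
    · have hX0 : X ω = 0 := Finset.sum_eq_zero fun i _ => Set.indicator_of_notMem (hω i) _
      rw [hX0, Set.indicator_of_mem hω]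
      simp
    · rw [Set.indicator_of_notMem hω]
      positivity
  have hfin := integral_mono (μ := μ) (hint B hBm)
    (((hYint.const_mul _).sub (hXint.const_mul _)).add (integrable_const 1)) hpt
  rw [integral_indicator_one hBm] at hfin
  have hcalc : ∫ ω, (1 / m ^ 2 * Y ω - 2 / m * X ω) + 1 ∂μ =
      1 / m ^ 2 * ∫ ω, Y ω ∂μ - 2 / m * ∫ ω, X ω ∂μ + 1 := by
    have hsub : Integrable (fun ω => 1 / m ^ 2 * Y ω - 2 / m * X ω) μ :=
      (hYint.const_mul _).sub (hXint.const_mul _)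
    rw [integral_add hsub (integrable_const 1), integral_sub (hYint.const_mul _) (hXint.const_mul _), integral_const_mul, integral_const_mul]
    simp
  have hfin' : μ.real B ≤ 1 / m ^ 2 * ∫ ω, Y ω ∂μ - 2 / m * ∫ ω, X ω ∂μ + 1 :=
    hfin.trans (le_of_eq hcalc)
  have a1 : 1 / m ^ 2 * ∫ ω, Y ω ∂μ ≤ 1 / m ^ 2 * (m + m ^ 2) := by gcongr
  have a2 : 2 / m * (N * (p * (1 - ε))) ≤ 2 / m * ∫ ω, X ω ∂μ := by gcongr
  have a3 : 1 / m ^ 2 * (m + m ^ 2) = 1 / m + 1 := by field_simp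
  have a4 : 2 / m * (N * (p * (1 - ε))) = 2 * (1 - ε) := by rw [hm]; field_simp
  linarith

/-! ### Lower bound: good cells -/

/-- The half-open axis-parallel square with lower left corner `z` and side `l`. -/
def cell (z : Plane) (l : ℝ) : Set Plane :=
  {q | q 0 ∈ Set.Ico (z 0) (z 0 + l) ∧ q 1 ∈ Set.Ico (z 1) (z 1 + l)}

/-- Three of the four corner squares of side `l / 8` of `cell z l`. -/
def cornerCell (z : Plane) (l : ℝ) : Fin 3 → Set Plane :=
  ![cell z (l / 8), cell (z + !₂[7 * l / 8, 0]) (l / 8), cell (z + !₂[0, 7 * l / 8]) (l / 8)]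

/-- What remains of `cell z l` when the three corner squares are removed. -/
def core (z : Plane) (l : ℝ) : Set Plane := cell z l \ ⋃ j, cornerCell z l j

theorem measurableSet_cell (z : Plane) (l : ℝ) : MeasurableSet (cell z l) :=
  (measurableSet_Ico.preimage (continuous_plane_coord 0).measurable).inter
    (measurableSet_Ico.preimage (continuous_plane_coord 1).measurable)

theorem measurableSet_cornerCell (z : Plane) (l : ℝ) (j : Fin 3) :
    MeasurableSet (cornerCell z l j) := by
  fin_cases j <;> exact measurableSet_cell _ _

theorem measurableSet_core (z : Plane) (l : ℝ) : MeasurableSet (core z l) :=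
  (measurableSet_cell z l).diff (MeasurableSet.iUnion (measurableSet_cornerCell z l))

theorem volume_cell (z : Plane) {l : ℝ} (hl : 0 ≤ l) :
    volume (cell z l) = ENNReal.ofReal (l ^ 2) := by
  rw [cell, volume_rectangle, Real.volume_Ico, Real.volume_Ico, ← ENNReal.ofReal_mul (by linarith)]
  congr 1
  ring

theorem volume_cornerCell (z : Plane) {l : ℝ} (hl : 0 ≤ l) (j : Fin 3) :
    volume (cornerCell z l j) = ENNReal.ofReal (l ^ 2 / 64) := by
  rw [show l ^ 2 / 64 = (l / 8) ^ 2 by ring]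
  fin_cases j <;> exact volume_cell _ (by positivity)

theorem cornerCell_subset_cell (z : Plane) {l : ℝ} (hl : 0 < l) (j : Fin 3) :
    cornerCell z l j ⊆ cell z l := by
  rintro q hq
  fin_cases j <;> simp [cornerCell, cell] at hq ⊢ <;> (obtain ⟨⟨a, b⟩, c, d⟩ := hq) <;>
    refine ⟨⟨?_, ?_⟩, ?_, ?_⟩ <;> linarith

theorem pairwise_disjoint_cornerCell (z : Plane) {l : ℝ} (hl : 0 < l) :
    Pairwise (Function.onFun Disjoint (cornerCell z l)) := by
  intro i j hij
  rw [Function.onFun, Set.disjoint_left]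
  intro q hi hj
  fin_cases i <;> fin_cases j <;> simp [cornerCell, cell] at hij hi hj <;>
    (obtain ⟨⟨a, b⟩, c, d⟩ := hi) <;> (obtain ⟨⟨a', b'⟩, c', d'⟩ := hj) <;> linarith

theorem core_subset_cell (z : Plane) (l : ℝ) : core z l ⊆ cell z l := Set.sdiff_subset

theorem volume_core (z : Plane) {l : ℝ} (hl : 0 < l) :
    volume (core z l) = ENNReal.ofReal (61 / 64 * l ^ 2) := by
  rw [core, measure_sdiff (Set.iUnion_subset (cornerCell_subset_cell z hl))
    (MeasurableSet.iUnion (measurableSet_cornerCell z l)).nullMeasurableSet,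
    measure_iUnion (pairwise_disjoint_cornerCell z hl) (measurableSet_cornerCell z l), tsum_fintype,
    Fin.sum_univ_three, volume_cornerCell z hl.le, volume_cornerCell z hl.le,
    volume_cornerCell z hl.le, volume_cell z hl.le, ← ENNReal.ofReal_add (by positivity) (by positivity),
    ← ENNReal.ofReal_add (by positivity) (by positivity), ← ENNReal.ofReal_sub _ (by positivity)]
  · congr 1
    ring
  · exact ne_top_of_le_ne_top (by rw [volume_cell z hl.le]; exact ENNReal.ofReal_ne_top)
      (measure_mono (Set.iUnion_subset (cornerCell_subset_cell z hl)))

theorem volume_core_union_cornerCell (z : Plane) {l : ℝ} (hl : 0 < l) (j : Fin 3) :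
    volume (core z l ∪ cornerCell z l j) = ENNReal.ofReal (61 / 64 * l ^ 2 + l ^ 2 / 64) := by
  rw [measure_union _ (measurableSet_cornerCell z l j), volume_core z hl, volume_cornerCell z hl.le,
    ENNReal.ofReal_add (by positivity) (by positivity)]
  exact Set.disjoint_left.mpr fun q hq hj => hq.2 (Set.mem_iUnion_of_mem j hj)

/-- The cell `cell z l` lies in `K`, and the points `x i` hit the three corner squares of the cell
and avoid the rest of it. -/
def IsGoodCell (K : Set Plane) {n : ℕ} (x : Fin n → Plane) (z : Plane) (l : ℝ) : Prop :=
  cell z l ⊆ K ∧ x ∈ avoid n (core z l) ∧ ∀ j, ∃ i, x i ∈ cornerCell z l j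

theorem disjoint_cell_grid (z : Plane) {l : ℝ} (hl : 0 < l) {a b : ℕ × ℕ} (hab : a ≠ b) :
    Disjoint (cell (z + !₂[a.1 * l, a.2 * l]) l) (cell (z + !₂[b.1 * l, b.2 * l]) l) := by
  have key : ∀ (i j : ℕ) (t y : ℝ), y + i * l ≤ t → t < y + i * l + l → y + j * l ≤ t →
      t < y + j * l + l → i = j := by
    intro i j t y h1 h2 h3 h4
    have h5 : (i : ℝ) < j + 1 := lt_of_mul_lt_mul_right (by linarith) hl.le
    have h6 : (j : ℝ) < i + 1 := lt_of_mul_lt_mul_right (by linarith) hl.le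
    have h7 : i < j + 1 := by exact_mod_cast h5
    have h8 : j < i + 1 := by exact_mod_cast h6
    omega
  rw [Set.disjoint_left]
  rintro q ⟨⟨h1, h2⟩, h3, h4⟩ ⟨⟨h1', h2'⟩, h3', h4'⟩
  simp at h1 h2 h3 h4 h1' h2' h3' h4'
  exact hab (Prod.ext (key _ _ _ _ h1 h2 h1' h2') (key _ _ _ _ h3 h4 h3' h4'))

theorem cell_grid_subset (z : Plane) {l : ℝ} (hl : 0 < l) {k : ℕ} {a : ℕ × ℕ} (h1 : a.1 < k)
    (h2 : a.2 < k) : cell (z + !₂[a.1 * l, a.2 * l]) l ⊆ cell z (k * l) := by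
  have key : ∀ (i : ℕ), i < k → (i : ℝ) * l + l ≤ k * l := by
    intro i hi
    have : (i : ℝ) + 1 ≤ k := by exact_mod_cast hi
    nlinarith
  have p1 : 0 ≤ (a.1 : ℝ) * l := by positivity
  have p2 : 0 ≤ (a.2 : ℝ) * l := by positivity
  have k1 := key _ h1
  have k2 := key _ h2
  rintro q ⟨⟨g1, g2⟩, g3, g4⟩
  simp at g1 g2 g3 g4
  exact ⟨⟨by linarith, by linarith⟩, by linarith, by linarith⟩

/-- Apply the second moment bound to a `k × k` grid, with `C` for an avoided core and `D` for a
missed corner. Cores are disjoint, and `1 - 2m ≤ (1 - m) ^ 2` gives the nonpositive correlation;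
similarly, avoiding a core and a corner together is at most the product of two powers. -/
theorem measureReal_not_isGoodCell_le {K : Set Plane} (hK1 : volume K = 1) (n : ℕ) {z : Plane}
    {l : ℝ} (hl : 0 < l) (hl1 : l < 1) {k : ℕ} (hk : 0 < k) (hz : cell z (k * l) ⊆ K) :
    (uniformPoints K n).real {x | ¬ ∃ w, IsGoodCell K x w l} ≤
      1 / ((k : ℝ) ^ 2 * (1 - l ^ 2) ^ n) + 6 * (1 - l ^ 2 / 64) ^ n := by
  have := isProbabilityMeasure_uniformPoints hK1 n
  have : NeZero k := ⟨hk.ne'⟩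
  set w : Fin k × Fin k → Plane := fun a => z + !₂[((a.1 : ℕ) : ℝ) * l, ((a.2 : ℕ) : ℝ) * l] with hw
  have hwK : ∀ a, cell (w a) l ⊆ K := fun a =>
    (cell_grid_subset z hl (a := (a.1, a.2)) a.1.2 a.2.2).trans hz
  have hreal : ∀ (V : Set Plane) (y : ℝ), MeasurableSet V → V ⊆ K → 0 ≤ y →
      volume V = ENNReal.ofReal y →
      y ≤ 1 ∧ (uniformPoints K n).real (avoid n V) = (1 - y) ^ n := by
    intro V y hV hVK hy hVy
    obtain ⟨h1, h2⟩ := uniformPoints_avoid_eq_ofReal hK1 n hV hVK hy hVy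
    refine ⟨h1, ?_⟩
    rw [measureReal_def, h2, ENNReal.toReal_ofReal (pow_nonneg (by linarith) n)]
  have hcoreK : ∀ a, core (w a) l ⊆ K := fun a => (core_subset_cell _ _).trans (hwK a)
  have hl2 : l ^ 2 < 1 := by nlinarith
  set m : ℝ := 61 / 64 * l ^ 2 with hm
  have hm0 : 0 ≤ m := by positivity
  have hm1 : 0 < 1 - m := by rw [hm]; nlinarith
  set ε : ℝ := 3 * (1 - l ^ 2 / 64) ^ n with hε
  have hmain := measureReal_forall_notMem_diff_le (uniformPoints K n)
    (C := fun a => avoid n (core (w a) l))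
    (D := fun a => ⋃ j, avoid n (cornerCell (w a) l j)) (p := (1 - m) ^ n) (ε := ε)
    (fun a => measurableSet_avoid n (measurableSet_core _ _))
    (fun a => MeasurableSet.iUnion fun j => measurableSet_avoid n (measurableSet_cornerCell _ _ _))
    (pow_pos hm1 n)
    (fun a => (hreal _ _ (measurableSet_core _ _) (hcoreK a) hm0 (volume_core _ hl)).2)
    (by
      intro a b hab
      have hdis : Disjoint (core (w a) l) (core (w b) l) := by
        refine Disjoint.mono (core_subset_cell _ _) (core_subset_cell _ _)
          (disjoint_cell_grid z hl (a := (a.1, a.2)) (b := (b.1, b.2)) ?_)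
        intro h
        rw [Prod.mk.injEq] at h
        exact hab (Prod.ext (Fin.ext h.1) (Fin.ext h.2))
      obtain ⟨h1, h2⟩ := hreal (core (w a) l ∪ core (w b) l) (m + m)
        ((measurableSet_core _ _).union (measurableSet_core _ _))
        (Set.union_subset (hcoreK a) (hcoreK b)) (by linarith)
        (by rw [measure_union hdis (measurableSet_core _ _), volume_core _ hl, volume_core _ hl,
              ENNReal.ofReal_add hm0 hm0])
      rw [avoid_inter_avoid, h2, ← pow_mul, mul_comm n 2, pow_mul]
      exact pow_le_pow_left₀ (by linarith) (by nlinarith) n)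
    (by
      intro a
      rw [Set.inter_iUnion]
      refine (measureReal_iUnion_fintype_le _).trans ?_
      have hterm : ∀ j, (uniformPoints K n).real
          (avoid n (core (w a) l) ∩ avoid n (cornerCell (w a) l j)) ≤
          (1 - l ^ 2 / 64) ^ n * (1 - m) ^ n := by
        intro j
        obtain ⟨h1, h2⟩ := hreal (core (w a) l ∪ cornerCell (w a) l j) (m + l ^ 2 / 64)
          ((measurableSet_core _ _).union (measurableSet_cornerCell _ _ _))
          (Set.union_subset (hcoreK a) ((cornerCell_subset_cell _ hl j).trans (hwK a)))
          (by positivity) (volume_core_union_cornerCell _ hl j)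
        rw [avoid_inter_avoid, h2, ← mul_pow]
        exact pow_le_pow_left₀ (by linarith) (by nlinarith [mul_nonneg hm0 (sq_nonneg l)]) n
      refine (Finset.sum_le_sum fun j _ => hterm j).trans (le_of_eq ?_)
      rw [Finset.sum_const, Finset.card_univ, Fintype.card_fin, nsmul_eq_mul, hε]
      push_cast
      ring)
  have hsub : {x : Fin n → Plane | ¬ ∃ w, IsGoodCell K x w l} ⊆
      {x | ∀ a, x ∉ avoid n (core (w a) l) \ ⋃ j, avoid n (cornerCell (w a) l j)} := by
    intro x hx a ha
    refine hx ⟨w a, hwK a, ha.1, fun j => ?_⟩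
    by_contra hcon
    exact ha.2 (Set.mem_iUnion_of_mem j fun i hi => hcon ⟨i, hi⟩)
  refine (measureReal_mono hsub).trans (hmain.trans ?_)
  rw [Fintype.card_prod, Fintype.card_fin]
  push_cast
  rw [← sq]
  have hkpos : (0 : ℝ) < (k : ℝ) ^ 2 := by positivity
  have h1 : 0 < (1 - l ^ 2) ^ n := pow_pos (by linarith) n
  have h2 : (1 - l ^ 2) ^ n ≤ (1 - m) ^ n :=
    pow_le_pow_left₀ (by linarith) (by rw [hm]; nlinarith) n
  have h3 : 1 / ((k : ℝ) ^ 2 * (1 - m) ^ n) ≤ 1 / ((k : ℝ) ^ 2 * (1 - l ^ 2) ^ n) := by gcongr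
  linarith

/-- With high probability there is a good cell of area at least `log n / (8 n)`. -/
theorem tendsto_not_isGoodCell {K : Set Plane} (hK : IsFiniteUnionOfConvex K)
    (hK1 : volume K = 1) :
    Tendsto (fun n : ℕ => uniformPoints K n {x | ¬ ∃ (w : Plane) (l : ℝ), 0 < l ∧
      1 / 8 * (Real.log n / n) ≤ l ^ 2 ∧ IsGoodCell K x w l}) atTop (𝓝 0) := by
  obtain ⟨y, hy⟩ := hK.interior_nonempty (by rw [hK1]; exact one_ne_zero)
  obtain ⟨r, hr, hball⟩ := Metric.isOpen_iff.mp isOpen_interior y hy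
  set s := r / 2 with hs
  have hs0 : 0 < s := by positivity
  have hcell : cell y s ⊆ K := by
    rintro q ⟨⟨h1, h2⟩, h3, h4⟩
    apply interior_subset (hball _)
    rw [Metric.mem_ball, EuclideanSpace.dist_eq, Real.sqrt_lt' hr, Fin.sum_univ_two, Real.dist_eq,
      Real.dist_eq, sq_abs, sq_abs]
    nlinarith
  have hlog : Tendsto (fun n : ℕ => Real.log n) atTop atTop :=
    Real.tendsto_log_atTop.comp tendsto_natCast_atTop_atTop
  have hdiv : Tendsto (fun n : ℕ => Real.log n / n) atTop (𝓝 0) :=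
    (Real.isLittleO_log_id_atTop.tendsto_div_nhds_zero).comp tendsto_natCast_atTop_atTop
  -- With `l²` between `log n / (8n)` and `log n / (2n)`, a cell is empty with probability at least
  -- `n ^ (-2/3)`, while there are at least of order `n / log n` cells; a corner is missed with
  -- probability at most `n ^ (-1/512)`.
  set F : ℕ → ℝ := fun n => 3 / (2 * s ^ 2) * ((Real.log n / 3) ^ 1 * Real.exp (-(Real.log n / 3))) +
    6 * Real.exp (-(Real.log n / 512)) with hF
  have hFlim : Tendsto F atTop (𝓝 0) := by
    have a1 := (Real.tendsto_pow_mul_exp_neg_atTop_nhds_zero 1).comp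
      (hlog.atTop_div_const (by norm_num : (0 : ℝ) < 3))
    have a2 := (Real.tendsto_exp_neg_atTop_nhds_zero).comp
      (hlog.atTop_div_const (by norm_num : (0 : ℝ) < 512))
    have := (a1.const_mul (3 / (2 * s ^ 2))).add (a2.const_mul 6)
    simpa [hF] using this
  have hbound : ∀ᶠ n : ℕ in atTop, uniformPoints K n {x | ¬ ∃ (w : Plane) (l : ℝ), 0 < l ∧
      1 / 8 * (Real.log n / n) ≤ l ^ 2 ∧ IsGoodCell K x w l} ≤ ENNReal.ofReal (F n) := by
    filter_upwards [eventually_ge_atTop 1, hlog.eventually_ge_atTop 1,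
      hdiv.eventually_le_const (show (0 : ℝ) < min (1 / 2) (2 * s ^ 2) by positivity)]
      with n hn1 hL hLn
    have := isProbabilityMeasure_uniformPoints hK1 n
    have hn0 : (0 : ℝ) < n := by exact_mod_cast hn1
    set L := Real.log n with hLdef
    have hL0 : 0 < L := by linarith
    have hLn1 := hLn.trans (min_le_left _ _)
    have hLn2 := hLn.trans (min_le_right _ _)
    set t := Real.sqrt (2 * n / L) with ht
    have ht0 : 0 < t := Real.sqrt_pos.mpr (by positivity)
    have ht2 : t ^ 2 = 2 * n / L := Real.sq_sqrt (by positivity)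
    have hst : 1 ≤ s * t := by
      have : 1 ≤ (s * t) ^ 2 := by
        rw [mul_pow, ht2, ← mul_div_assoc, le_div_iff₀ hL0, one_mul]
        rw [div_le_iff₀ hn0] at hLn2
        linarith
      nlinarith [mul_pos hs0 ht0]
    set k := ⌈s * t⌉₊ with hk
    have hk0 : 0 < k := Nat.ceil_pos.mpr (by linarith)
    have hk0' : (0 : ℝ) < k := by exact_mod_cast hk0
    have hk1 : s * t ≤ k := Nat.le_ceil _
    have hk2 : (k : ℝ) ≤ 2 * (s * t) := by
      have := (Nat.ceil_lt_add_one (by positivity : 0 ≤ s * t)).le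
      linarith
    set l := s / k with hl
    have hl0 : 0 < l := by positivity
    have hlk : (k : ℝ) * l = s := by rw [hl]; field_simp
    have hlle : l ^ 2 ≤ L / (2 * n) := by
      have h1 : l ≤ 1 / t := by
        rw [hl, div_le_div_iff₀ hk0' ht0]; linarith
      calc l ^ 2 ≤ (1 / t) ^ 2 := pow_le_pow_left₀ hl0.le h1 2
        _ = L / (2 * n) := by rw [div_pow, ht2]; field_simp
    have hlge : 1 / 8 * (L / n) ≤ l ^ 2 := by
      have h1 : 1 / (2 * t) ≤ l := by
        rw [hl, div_le_div_iff₀ (by positivity) hk0']; linarith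
      calc 1 / 8 * (L / n) = (1 / (2 * t)) ^ 2 := by rw [div_pow, mul_pow, ht2]; field_simp; norm_num
        _ ≤ l ^ 2 := pow_le_pow_left₀ (by positivity) h1 2
    have hhalf : L / (2 * n) = (L / n) / 2 := by field_simp
    have hl4 : l ^ 2 ≤ 1 / 4 := by linarith
    have hl1 : l < 1 := by nlinarith
    have hmeas := measureReal_not_isGoodCell_le hK1 n hl0 hl1 hk0 (z := y) (by rw [hlk]; exact hcell)
    have hsub : {x : Fin n → Plane | ¬ ∃ (w : Plane) (l : ℝ), 0 < l ∧
        1 / 8 * (L / n) ≤ l ^ 2 ∧ IsGoodCell K x w l} ⊆ {x | ¬ ∃ w, IsGoodCell K x w l} :=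
      fun x hx ⟨w, hw⟩ => hx ⟨w, l, hl0, hlge, hw⟩
    refine (measure_mono hsub).trans ?_
    rw [← ofReal_measureReal]
    refine ENNReal.ofReal_le_ofReal (hmeas.trans ?_)
    have hexpL : Real.exp L = n := Real.exp_log hn0
    have hpow1 : Real.exp (-(2 * L / 3)) ≤ (1 - l ^ 2) ^ n := by
      -- `1 / (1 - y) ≤ 1 + 4 * y / 3` holds for `0 ≤ y ≤ 1 / 4`, whence the earlier bound `hl4`.
      have h1 : Real.exp (-(4 / 3 * l ^ 2)) ≤ 1 - l ^ 2 := by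
        have h2 : 1 / (1 - l ^ 2) ≤ Real.exp (4 / 3 * l ^ 2) := by
          refine le_trans ?_ (Real.add_one_le_exp _)
          rw [div_le_iff₀ (by linarith)]
          nlinarith [sq_nonneg l]
        rw [Real.exp_neg, inv_le_comm₀ (Real.exp_pos _) (by linarith), ← one_div]
        exact h2
      calc Real.exp (-(2 * L / 3)) ≤ Real.exp (n * (-(4 / 3 * l ^ 2))) := by
            rw [Real.exp_le_exp]
            have : n * l ^ 2 ≤ L / 2 := by
              calc n * l ^ 2 ≤ n * (L / (2 * n)) := by gcongr
                _ = L / 2 := by field_simp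
            linarith
        _ = Real.exp (-(4 / 3 * l ^ 2)) ^ n := Real.exp_nat_mul _ _
        _ ≤ (1 - l ^ 2) ^ n := pow_le_pow_left₀ (Real.exp_pos _).le h1 n
    have hpow2 : (1 - l ^ 2 / 64) ^ n ≤ Real.exp (-(L / 512)) := by
      calc (1 - l ^ 2 / 64) ^ n ≤ Real.exp (-(l ^ 2 / 64)) ^ n :=
            pow_le_pow_left₀ (by linarith) (Real.one_sub_le_exp_neg _) n
        _ = Real.exp (n * (-(l ^ 2 / 64))) := (Real.exp_nat_mul _ _).symm
        _ ≤ Real.exp (-(L / 512)) := by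
            rw [Real.exp_le_exp]
            have : L / 8 ≤ n * l ^ 2 := by
              calc L / 8 = n * (1 / 8 * (L / n)) := by field_simp
                _ ≤ n * l ^ 2 := by gcongr
            linarith
    have hk3 : s ^ 2 * (2 * n / L) ≤ (k : ℝ) ^ 2 := by
      rw [← ht2, ← mul_pow]
      exact pow_le_pow_left₀ (by positivity) hk1 2
    have hfirst : 1 / ((k : ℝ) ^ 2 * (1 - l ^ 2) ^ n) ≤
        3 / (2 * s ^ 2) * ((L / 3) ^ 1 * Real.exp (-(L / 3))) := by
      have h1 : s ^ 2 * (2 * n / L) * Real.exp (-(2 * L / 3)) ≤ (k : ℝ) ^ 2 * (1 - l ^ 2) ^ n := by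
        gcongr
      have h2 : s ^ 2 * (2 * n / L) * Real.exp (-(2 * L / 3)) = s ^ 2 * 2 / L * Real.exp (L / 3) := by
        rw [← hexpL, show L / 3 = L + -(2 * L / 3) by ring, Real.exp_add]
        ring
      rw [h2] at h1
      calc 1 / ((k : ℝ) ^ 2 * (1 - l ^ 2) ^ n) ≤ 1 / (s ^ 2 * 2 / L * Real.exp (L / 3)) := by
            gcongr
        _ = _ := by
            rw [Real.exp_neg]
            field_simp
    simp only [hF]
    linarith
  refine tendsto_of_tendsto_of_tendsto_of_le_of_le' tendsto_const_nhds ?_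
    (Eventually.of_forall fun _ => bot_le) hbound
  rw [← ENNReal.ofReal_zero]
  exact ENNReal.tendsto_ofReal hFlim

/-! ### Empty triangles and homothetic copies in a good cell -/

theorem cross_sub_cyclic (a b c : Plane) : cross (b - a) (c - a) = cross (c - b) (a - b) := by
  simp [cross]; ring

theorem convex_cross_le (w a : Plane) (d : ℝ) : Convex ℝ {q | cross w (q - a) ≤ d} := by
  intro p hp q hq s t hs ht hst
  simp only [Set.mem_ofPred_eq] at hp hq ⊢
  have : cross w (s • p + t • q - a) = s * cross w (p - a) + t * cross w (q - a) := by
    obtain rfl : s = 1 - t := by linarith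
    simp [cross]; ring
  rw [this]
  calc s * cross w (p - a) + t * cross w (q - a) ≤ s * d + t * d := by gcongr
    _ = d := by rw [← add_mul, hst, one_mul]

/-- Replacing a vertex of a triangle by an interior point decreases the area. -/
theorem cross_lt_of_mem_interior_convexHull {a b c q : Plane} (hD : 0 < cross (b - a) (c - a))
    (hq : q ∈ interior (convexHull ℝ {a, b, c})) :
    cross (b - q) (c - q) < cross (b - a) (c - a) := by
  have hle : ∀ p ∈ convexHull ℝ {a, b, c}, cross (c - b) (p - b) ≤ cross (b - a) (c - a) := by
    refine convexHull_min ?_ (convex_cross_le _ _ _)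
    rintro p (rfl | rfl | rfl)
    · exact (cross_sub_cyclic _ _ _).ge
    · change cross (c - p) (p - p) ≤ _
      rw [show cross (c - p) (p - p) = 0 by simp [cross]]
      exact hD.le
    · change cross (p - b) (p - b) ≤ _
      rw [show cross (p - b) (p - b) = 0 by simp [cross]; ring]
      exact hD.le
  obtain ⟨ε, hε, hball⟩ := Metric.isOpen_iff.mp isOpen_interior q hq
  -- An interior point can be pushed a little along `a - b`, which raises the functional `cross (c -
  -- b)` by `t` times the determinant; its maximum over the triangle bounds the result.
  set t := ε / (2 * (‖a - b‖ + 1)) with ht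
  have ht0 : 0 < t := by positivity
  have hmem : q + t • (a - b) ∈ convexHull ℝ {a, b, c} := by
    apply interior_subset (hball _)
    rw [Metric.mem_ball, dist_self_add_left, norm_smul, Real.norm_of_nonneg ht0.le, ht,
      div_mul_eq_mul_div, div_lt_iff₀ (by positivity)]
    nlinarith [norm_nonneg (a - b)]
  have h := hle _ hmem
  have e : cross (c - b) (q + t • (a - b) - b) =
      cross (b - q) (c - q) + t * cross (b - a) (c - a) := by
    simp [cross]; ring
  rw [e] at h
  nlinarith

theorem convex_cell (z : Plane) (l : ℝ) : Convex ℝ (cell z l) := by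
  have h : ∀ i : Fin 2, Convex ℝ {q : Plane | q i ∈ Set.Ico (z i) (z i + l)} := fun i =>
    (convex_Ico (z i) (z i + l)).linear_preimage (EuclideanSpace.proj i).toLinearMap
  exact (h 0).inter (h 1)

/-- The worst case is `(3/4)² - (1/8)² = 35/64` times `l²`. -/
theorem cross_cornerCell_ge {z : Plane} {l : ℝ} (hl : 0 < l) {a b c : Plane}
    (ha : a ∈ cornerCell z l 0) (hb : b ∈ cornerCell z l 1) (hc : c ∈ cornerCell z l 2) :
    l ^ 2 / 2 ≤ cross (b - a) (c - a) := by
  simp [cornerCell, cell] at ha hb hc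
  obtain ⟨⟨a1, a2⟩, a3, a4⟩ := ha
  obtain ⟨⟨b1, b2⟩, b3, b4⟩ := hb
  obtain ⟨⟨c1, c2⟩, c3, c4⟩ := hc
  have h1 : 3 * l / 4 * (3 * l / 4) ≤ (b 0 - a 0) * (c 1 - a 1) := by
    apply mul_le_mul <;> linarith
  have h2 : |(b 1 - a 1) * (c 0 - a 0)| ≤ l / 8 * (l / 8) := by
    rw [abs_mul]
    apply mul_le_mul _ _ (abs_nonneg _) (by positivity) <;> rw [abs_le] <;> constructor <;> linarith
  have h3 := (abs_le.mp h2).2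
  simp only [cross, PiLp.sub_apply]
  nlinarith [sq_nonneg l]

/-- A good cell contains an empty triangle of comparable area. -/
theorem IsGoodCell.exists_polygon {K : Set Plane} {n : ℕ} {x : Fin n → Plane} {z : Plane} {l : ℝ}
    (hl : 0 < l) (h : IsGoodCell K x z l) :
    ∃ H, (IsHole K x H ∧ IsConvexPolygonOn x H) ∧ ENNReal.ofReal (1 / 8 * l ^ 2) ≤ volume H := by
  classical
  obtain ⟨hK, havoid, hcorner⟩ := h
  set T : Finset (Fin n × Fin n × Fin n) := Finset.univ.filter fun i =>
    x i.1 ∈ cornerCell z l 0 ∧ x i.2.1 ∈ cornerCell z l 1 ∧ x i.2.2 ∈ cornerCell z l 2 with hT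
  have hTne : T.Nonempty := by
    obtain ⟨i, hi⟩ := hcorner 0
    obtain ⟨j, hj⟩ := hcorner 1
    obtain ⟨k, hk⟩ := hcorner 2
    exact ⟨(i, j, k), by simp [hT, hi, hj, hk]⟩
  -- Minimality forces emptiness: a sample point inside the triangle lies in the cell but not in the
  -- core, hence in a corner square. Putting it in place of the vertex from that square gives a
  -- smaller admissible triangle. Cyclic symmetry brings the replaced vertex to first position.
  obtain ⟨⟨i, j, k⟩, hmem, hmin⟩ := Finset.exists_min_image T
    (fun i => cross (x i.2.1 - x i.1) (x i.2.2 - x i.1)) hTne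
  rw [hT, Finset.mem_filter] at hmem
  obtain ⟨-, hi, hj, hk⟩ := hmem
  simp only at hi hj hk
  have hmin' : ∀ i' j' k', x i' ∈ cornerCell z l 0 → x j' ∈ cornerCell z l 1 →
      x k' ∈ cornerCell z l 2 → cross (x j - x i) (x k - x i) ≤ cross (x j' - x i') (x k' - x i') :=
    fun i' j' k' h1 h2 h3 => hmin (i', j', k') (by simp [hT, h1, h2, h3])
  have hDge := cross_cornerCell_ge hl hi hj hk
  have hD : 0 < cross (x j - x i) (x k - x i) := lt_of_lt_of_le (by positivity) hDge
  set H := convexHull ℝ {x i, x j, x k} with hH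
  have hHcell : H ⊆ cell z l := by
    refine convexHull_min ?_ (convex_cell z l)
    rintro p (rfl | rfl | rfl)
    · exact cornerCell_subset_cell z hl _ hi
    · exact cornerCell_subset_cell z hl _ hj
    · exact cornerCell_subset_cell z hl _ hk
  refine ⟨H, ⟨⟨hHcell.trans hK, fun m hm => ?_⟩, {i, j, k}, ?_⟩, ?_⟩
  · have hmc : x m ∈ ⋃ j, cornerCell z l j := by
      by_contra hcon
      exact havoid m ⟨hHcell (interior_subset hm), hcon⟩
    obtain ⟨c, hc⟩ := Set.mem_iUnion.mp hmc
    fin_cases c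
    · exact absurd (hmin' m j k hc hj hk)
        (not_le.mpr (cross_lt_of_mem_interior_convexHull hD hm))
    · have h1 := hmin' i m k hi hc hk
      rw [cross_sub_cyclic (x i) (x m), cross_sub_cyclic (x i) (x j)] at h1
      rw [cross_sub_cyclic (x i) (x j)] at hD
      refine absurd h1 (not_le.mpr (cross_lt_of_mem_interior_convexHull hD ?_))
      rwa [show ({x j, x k, x i} : Set Plane) = {x i, x j, x k} by
        ext; simp only [Set.mem_insert_iff, Set.mem_singleton_iff]; tauto]
    · have h1 := hmin' i j m hi hj hc
      rw [← cross_sub_cyclic (x m) (x i), ← cross_sub_cyclic (x k) (x i)] at h1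
      rw [← cross_sub_cyclic (x k) (x i)] at hD
      refine absurd h1 (not_le.mpr (cross_lt_of_mem_interior_convexHull hD ?_))
      rwa [show ({x k, x i, x j} : Set Plane) = {x i, x j, x k} by
        ext; simp only [Set.mem_insert_iff, Set.mem_singleton_iff]; tauto]
  · rw [hH]
    congr 1
    simp [Set.image_insert_eq]
  · have hv : ∀ y ∈ ({x i, x j, x k} : Set Plane), y ∈ H := fun y hy => subset_convexHull ℝ _ hy
    refine le_trans ?_ (measure_mono (openParallelogram_subset_of_convex (convex_convexHull ℝ _)
      (hv (x i) (by simp)) (hv (x j) (by simp)) (hv (x k) (by simp))))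
    rw [volume_openParallelogram]
    apply ENNReal.ofReal_le_ofReal
    rw [show cross ((1 / 4 : ℝ) • (x j - x i)) ((1 / 4 : ℝ) • (x k - x i)) =
      (1 / 16) * cross (x j - x i) (x k - x i) by simp [cross]; ring, abs_mul, abs_of_pos hD,
      abs_of_pos (by norm_num : (0 : ℝ) < 1 / 16)]
    linarith

theorem mem_core_of_abs_sub_le {z q : Plane} {l : ℝ} (hl : 0 < l)
    (h : ∀ i, |q i - (z i + l / 2)| ≤ l / 4) : q ∈ core z l := by
  have h0 := abs_le.mp (h 0)
  have h1 := abs_le.mp (h 1)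
  refine ⟨⟨⟨by linarith, by linarith⟩, by linarith, by linarith⟩, fun hq => ?_⟩
  obtain ⟨j, hj⟩ := Set.mem_iUnion.mp hq
  fin_cases j <;> simp [cornerCell, cell] at hj <;> (obtain ⟨⟨a, b⟩, c, d⟩ := hj) <;> linarith

/-- A good cell contains an empty homothetic copy of comparable size of any bounded set. -/
theorem IsGoodCell.exists_homothetic {K : Set Plane} {n : ℕ} {x : Fin n → Plane} {z : Plane} {l : ℝ}
    (hl : 0 < l) (h : IsGoodCell K x z l) {L : Set Plane} {R : ℝ} (hR : 0 < R)
    (hL : ∀ q ∈ L, ‖q‖ ≤ R) :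
    ∃ H, (IsHole K x H ∧ IsHomotheticTo L H) ∧
      volume H = ENNReal.ofReal ((l / (4 * R)) ^ 2) * volume L := by
  have hr : 0 < l / (4 * R) := by positivity
  set w : Plane := z + !₂[l / 2, l / 2] with hw
  -- The copy fits in the concentric square of side `l / 2`, which the corner squares do not reach.
  have hsub : w +ᵥ (l / (4 * R)) • L ⊆ core z l := by
    rintro _ ⟨_, ⟨q, hq, rfl⟩, rfl⟩
    refine mem_core_of_abs_sub_le hl fun i => ?_
    have h1 : |q i| ≤ R := (PiLp.norm_apply_le q i).trans (hL q hq)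
    have h2 : w i = z i + l / 2 := by
      fin_cases i <;> simp [hw]
    have h3 : (w +ᵥ (l / (4 * R)) • q) i - (z i + l / 2) = l / (4 * R) * q i := by
      simp [h2]
    change |(w +ᵥ (l / (4 * R)) • q) i - (z i + l / 2)| ≤ _
    rw [h3, abs_mul, abs_of_pos hr]
    calc l / (4 * R) * |q i| ≤ l / (4 * R) * R := by gcongr
      _ = l / 4 := by field_simp
  refine ⟨w +ᵥ (l / (4 * R)) • L, ⟨⟨hsub.trans ((core_subset_cell z l).trans h.1),
    fun i hi => h.2.1 i (hsub (interior_subset hi))⟩, _, w, hr, rfl⟩, ?_⟩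
  rw [measure_vadd, Measure.addHaar_smul, finrank_euclideanSpace_fin, abs_of_pos (by positivity)]

/-! ### Comparison of the three maxima and conclusion -/

theorem maxPolygon_le_maxConvex (K : Set Plane) {n : ℕ} (x : Fin n → Plane) :
    maxPolygon K x ≤ maxConvex K x := by
  refine iSup₂_le fun H hH => le_iSup₂_of_le H ⟨hH.1, ?_⟩ le_rfl
  obtain ⟨s, rfl⟩ := hH.2
  exact convex_convexHull ℝ _

/-- `L` need not be convex, but it contains a disc. The corresponding disc in a homothetic hole is a
convex hole, and the ratio of areas does not depend on the scale. -/
theorem maxHomothetic_le_mul_maxConvex {L : Set Plane} (hLv : volume L ≠ ⊤)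
    (hLi : (interior L).Nonempty) :
    ∃ κ : ℝ, 0 < κ ∧ ∀ (K : Set Plane) (n : ℕ) (x : Fin n → Plane),
      maxHomothetic L K x ≤ ENNReal.ofReal κ * maxConvex K x := by
  obtain ⟨p, hp⟩ := hLi
  obtain ⟨ρ, hρ, hball⟩ := Metric.isOpen_iff.mp isOpen_interior p hp
  set B := Metric.ball p ρ with hB
  have hBL : B ⊆ L := hball.trans interior_subset
  have hB0 : 0 < volume B := Metric.measure_ball_pos volume p hρ
  have hBt : volume B ≠ ⊤ := ne_top_of_le_ne_top hLv (measure_mono hBL)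
  have hκ : volume L / volume B ≠ ⊤ := ENNReal.div_ne_top hLv hB0.ne'
  refine ⟨(volume L / volume B).toReal, ENNReal.toReal_pos ?_ hκ, fun K n x => ?_⟩
  · exact (ENNReal.div_pos (hB0.trans_le (measure_mono hBL)).ne' hBt).ne'
  rw [ENNReal.ofReal_toReal hκ]
  refine iSup₂_le fun H hH => ?_
  obtain ⟨⟨hHK, hx⟩, r, v, hr, rfl⟩ := hH
  have hsub : v +ᵥ r • B ⊆ v +ᵥ r • L := Set.vadd_set_mono (Set.smul_set_mono hBL)
  have hopen : IsOpen (v +ᵥ r • B) := (Metric.isOpen_ball.smul₀ hr.ne').vadd v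
  have hle : volume (v +ᵥ r • B) ≤ maxConvex K x := by
    refine le_iSup₂_of_le _ ⟨⟨hsub.trans hHK, fun i hi => hx i ?_⟩, ?_⟩ le_rfl
    · exact interior_mono hsub hi
    · exact ((convex_ball p ρ).smul r).vadd v
  refine le_trans (le_of_eq ?_) (mul_le_mul_right hle _)
  rw [measure_vadd, measure_vadd, Measure.addHaar_smul, Measure.addHaar_smul, mul_left_comm,
    ENNReal.div_mul_cancel hB0.ne' hBt]

theorem WhpThetaLogDiv.of_tendsto {K : Set Plane} {Y : (n : ℕ) → (Fin n → Plane) → ℝ≥0∞} {c C : ℝ}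
    (hc : 0 < c) (hC : 0 < C)
    (h1 : Tendsto (fun n : ℕ => uniformPoints K n
      {x | ¬ ENNReal.ofReal (c * (Real.log n / n)) ≤ Y n x}) atTop (𝓝 0))
    (h2 : Tendsto (fun n : ℕ => uniformPoints K n
      {x | ¬ Y n x ≤ ENNReal.ofReal (C * (Real.log n / n))}) atTop (𝓝 0)) :
    WhpThetaLogDiv K Y := by
  refine ⟨c, C, hc, hC, tendsto_of_tendsto_of_tendsto_of_le_of_le tendsto_const_nhds
    (by simpa only [add_zero] using h1.add h2) (fun _ => bot_le) fun n => ?_⟩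
  refine (measure_mono ?_).trans (measure_union_le _ _)
  intro x hx
  rw [Set.mem_ofPred_eq, not_and_or] at hx
  exact hx

theorem tendsto_measure_zero_mono {K : Set Plane} {A B : (n : ℕ) → Set (Fin n → Plane)}
    (hB : Tendsto (fun n => uniformPoints K n (B n)) atTop (𝓝 0)) (h : ∀ n, A n ⊆ B n) :
    Tendsto (fun n => uniformPoints K n (A n)) atTop (𝓝 0) :=
  tendsto_of_tendsto_of_tendsto_of_le_of_le tendsto_const_nhds hB (fun _ => bot_le)
    fun n => measure_mono (h n)

theorem theorem5 (K : Set Plane) (hK : IsFiniteUnionOfConvex K) (hK1 : volume K = 1) :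
    (∀ L : Set Plane, Bornology.IsBounded L → (interior L).Nonempty →
      WhpThetaLogDiv K (fun _ x => maxHomothetic L K x)) ∧
    WhpThetaLogDiv K (fun _ x => maxConvex K x) ∧
    WhpThetaLogDiv K (fun _ x => maxPolygon K x) := by
  have hupper : Tendsto (fun n : ℕ => uniformPoints K n
      {x | ¬ maxConvex K x ≤ ENNReal.ofReal (12800 * (Real.log n / n))}) atTop (𝓝 0) := by
    refine tendsto_measure_zero_mono (tendsto_large_convex_hole hK hK1) fun n x hx => ?_
    by_contra hcon
    exact hx (iSup₂_le fun H hH => not_lt.mp fun hlt => hcon ⟨H, hH, hlt⟩)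
  have hlower : Tendsto (fun n : ℕ => uniformPoints K n
      {x | ¬ ENNReal.ofReal (1 / 64 * (Real.log n / n)) ≤ maxPolygon K x}) atTop (𝓝 0) := by
    refine tendsto_measure_zero_mono (tendsto_not_isGoodCell hK hK1) fun n x hx hgood => hx ?_
    obtain ⟨w, l, hl, hlge, hw⟩ := hgood
    obtain ⟨H, hH, hvol⟩ := hw.exists_polygon hl
    refine le_trans ?_ (hvol.trans (le_iSup₂_of_le H hH le_rfl))
    exact ENNReal.ofReal_le_ofReal (by linarith)
  refine ⟨fun L hLb hLi => ?_, ?_, ?_⟩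
  · obtain ⟨R, hR, hLR⟩ := hLb.exists_pos_norm_le
    have hLt : volume L ≠ ⊤ := hLb.measure_lt_top.ne
    have hL0 : 0 < (volume L).toReal := ENNReal.toReal_pos
      ((isOpen_interior.measure_pos volume hLi).trans_le (measure_mono interior_subset)).ne' hLt
    obtain ⟨κ, hκ, hle⟩ := maxHomothetic_le_mul_maxConvex hLt hLi
    -- 128 = 8 * 4²: the good cell has `l² ≥ log n / (8n)`, and the copy has ratio `l / (4 * R)`.
    refine WhpThetaLogDiv.of_tendsto (c := (volume L).toReal / (128 * R ^ 2)) (C := κ * 12800)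
      (by positivity) (by positivity) ?_ ?_
    · refine tendsto_measure_zero_mono (tendsto_not_isGoodCell hK hK1) fun n x hx hgood => hx ?_
      obtain ⟨w, l, hl, hlge, hw⟩ := hgood
      obtain ⟨H, hH, hvol⟩ := hw.exists_homothetic hl hR hLR
      refine le_trans ?_ (le_iSup₂_of_le H hH le_rfl)
      rw [hvol, ← ENNReal.ofReal_toReal hLt, ← ENNReal.ofReal_mul (by positivity)]
      apply ENNReal.ofReal_le_ofReal
      rw [ENNReal.toReal_ofReal hL0.le]
      calc (volume L).toReal / (128 * R ^ 2) * (Real.log n / n)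
          = (1 / 8 * (Real.log n / n)) / (4 * R) ^ 2 * (volume L).toReal := by field_simp; ring
        _ ≤ l ^ 2 / (4 * R) ^ 2 * (volume L).toReal := by gcongr
        _ = (l / (4 * R)) ^ 2 * (volume L).toReal := by rw [div_pow]
    · refine tendsto_measure_zero_mono hupper fun n x hx hgood => hx ?_
      refine (hle K n x).trans ((mul_le_mul_right hgood _).trans (le_of_eq ?_))
      rw [← ENNReal.ofReal_mul hκ.le, mul_assoc]
  · refine WhpThetaLogDiv.of_tendsto (by norm_num : (0 : ℝ) < 1 / 64)
      (by norm_num : (0 : ℝ) < 12800) ?_ hupper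
    exact tendsto_measure_zero_mono hlower fun n x hx h =>
      hx (h.trans (maxPolygon_le_maxConvex K x))
  · refine WhpThetaLogDiv.of_tendsto (by norm_num : (0 : ℝ) < 1 / 64)
      (by norm_num : (0 : ℝ) < 12800) hlower ?_
    exact tendsto_measure_zero_mono hupper fun n x hx h =>
      hx ((maxPolygon_le_maxConvex K x).trans h)
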